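/- Let $V=(A_1,A_2,H,\Phi,E,\sigma_1,\sigma_2,\gamma^{in},\gamma^{out})$ be a two-operator commutative vessel: $H$ is a complex Hilbert space, $E$ a finite-dimensional complex Hilbert space, $A_1,A_2$ are commuting bounded operators on $H$, $\Phi:H\to E$ is bounded, $\sigma_1,\sigma_2,\gamma^{in},\gamma^{out}$ are selfadjoint operators on $E$, and $$\Phi^*\sigma_k\Phi=\tfrac1i(A_k-A_k^*)\ (k=1,2),\qquad \gamma^{in}\Phi=\sigma_1\Phi A_2^*-\sigma_2\Phi A_1^*,\qquad \gamma^{out}\Phi=\sigma_1\Phi A_2-\sigma_2\Phi A_1,$$ $$\gamma^{out}=\gamma^{in}+i(\sigma_1\Phi\Phi^*\sigma_2-\sigma_2\Phi\Phi^*\sigma_1).$$ The discriminant variety of $V$ is $C=\{y\in\mathbb C^2:\det(y_1\sigma_2-y_2\sigma_1+\gamma^{in})=0\}$. Let $p_0,p_1,p_2\in\mathbb R[y_1,y_2]$, not all constant, be such that $p_0(A_1,A_2)$ is invertible. Let $n\ge1$ be the maximum of their degrees, let $P_0,P_1,P_2\in\mathbb R[x_0,x_1,x_2]$ be their homogenizations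 up to degree $n$, and let $r=(p_1/p_0,\,p_2/p_0)$. Let $C'=r(C)$ be the image curve, i.e. the Zariski closure in $\mathbb C^2$ of $\{r(y): y\in C,\ p_0(y)\ne0\}$. Let $W_n$ be the Hilbert space of families $w=(w_i)$ of vectors of $E$ indexed by $i=(i_0,i_1,i_2)\in\mathbb Z_{\ge0}^3$ with $i_0+i_1+i_2=n-1$, and let $$V_n=\{w\in W_n:\ \gamma^{in}w_{j+e_0}+\sigma_2w_{j+e_1}-\sigma_1w_{j+e_2}=0\ \text{ for all } j\in\mathbb Z_{\ge0}^3,\ j_0+j_1+j_2=n-2\},$$ where $e_0,e_1,e_2$ are the unit vectors. For homogeneous $P,Q$ of degree $n$ choose real symmetric matrices $\beta^{10},\beta^{20},\beta^{12}$, indexed by the exponents $i$ with $i_0+i_1+i_2=n-1$ (such matrices exist), with $$P(x)Q(y)-Q(x)P(y)=\sum_{i,j}\big(\beta^{10}_{ij}x^i(x_1y_0-x_0y_1)y^j+\beta^{20}_{ij}x^i(x_2y_0-x_0y_2)y^j+\beta^{12}_{ij}x^i(x_1y_2-x_2y_1)y^j\big),$$ and let $B'(P,Q)$ be the compression to $V_n$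 of $\beta^{12}\otimes\gamma^{in}+\beta^{10}\otimes\sigma_1+\beta^{20}\otimes\sigma_2$. Let $V'=(A_1',A_2',H,\Phi',E',\sigma_1',\sigma_2',\gamma'^{in},\gamma'^{out})$, where $A_k'=p_k(A_1,A_2)\,p_0(A_1,A_2)^{-1}$, $E'=V_n$, $\Phi'=\mathcal P_{V_n}\big(\Phi A_1^{*i_1}A_2^{*i_2}p_0(A_1^*,A_2^*)^{-1}\big)_i$, $\sigma_1'=B'(P_1,P_0)$, $\sigma_2'=B'(P_2,P_0)$, $\gamma'^{in}=B'(P_1,P_2)$ and $\gamma'^{out}=\gamma'^{in}+i(\sigma_1'\Phi'\Phi'^*\sigma_2'-\sigma_2'\Phi'\Phi'^*\sigma_1')$. Then, for every choice of the matrices $\beta$, the discriminant variety $\{y\in\mathbb C^2:\det(y_1\sigma_2'-y_2\sigma_1'+\gamma'^{in})=0\}$ of $V'$ contains $C'$. -/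

import Mathlib

/-! ### Two-operator vessels -/

/-- The data of a two-operator vessel with inner space `H` and external space `E`
(`γin = γ₁₂ⁱⁿ`, `γout = γ₁₂ᵒᵘᵗ`); the laws are in `VesselData.IsVessel`. -/
structure VesselData (H E : Type*)
    [NormedAddCommGroup H] [InnerProductSpace ℂ H]
    [NormedAddCommGroup E] [InnerProductSpace ℂ E] where
  A₁ : H →L[ℂ] H
  A₂ : H →L[ℂ] H
  Φ : H →L[ℂ] E
  σ₁ : E →L[ℂ] E
  σ₂ : E →L[ℂ] E
  γin : E →L[ℂ] E
  γout : E →L[ℂ] E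

open ContinuousLinearMap in
/-- The laws of a commutative two-operator vessel. -/
structure VesselData.IsVessel {H E : Type*}
    [NormedAddCommGroup H] [InnerProductSpace ℂ H] [CompleteSpace H]
    [NormedAddCommGroup E] [InnerProductSpace ℂ E] [CompleteSpace E]
    (V : VesselData H E) : Prop where
  comm : V.A₁ ∘L V.A₂ = V.A₂ ∘L V.A₁
  selfAdjoint_σ₁ : IsSelfAdjoint V.σ₁
  selfAdjoint_σ₂ : IsSelfAdjoint V.σ₂
  selfAdjoint_γin : IsSelfAdjoint V.γin
  selfAdjoint_γout : IsSelfAdjoint V.γout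
  colligation₁ : adjoint V.Φ ∘L V.σ₁ ∘L V.Φ = (1 / Complex.I) • (V.A₁ - adjoint V.A₁)
  colligation₂ : adjoint V.Φ ∘L V.σ₂ ∘L V.Φ = (1 / Complex.I) • (V.A₂ - adjoint V.A₂)
  input : V.γin ∘L V.Φ = V.σ₁ ∘L V.Φ ∘L adjoint V.A₂ - V.σ₂ ∘L V.Φ ∘L adjoint V.A₁
  output : V.γout ∘L V.Φ = V.σ₁ ∘L V.Φ ∘L V.A₂ - V.σ₂ ∘L V.Φ ∘L V.A₁
  linkage : V.γout = V.γin + Complex.I •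
    (V.σ₁ ∘L V.Φ ∘L adjoint V.Φ ∘L V.σ₂ - V.σ₂ ∘L V.Φ ∘L adjoint V.Φ ∘L V.σ₁)

/-- The discriminant polynomial `Δ(y₁, y₂) = det (y₁ σ₂ - y₂ σ₁ + γⁱⁿ)`, as a polynomial function;
the point `(y₁, y₂)` is `(y 0, y 1)`. -/
noncomputable def VesselData.discriminant {H E : Type*}
    [NormedAddCommGroup H] [InnerProductSpace ℂ H]
    [NormedAddCommGroup E] [InnerProductSpace ℂ E]
    (V : VesselData H E) (y : Fin 2 → ℂ) : ℂ :=
  LinearMap.det (y 0 • V.σ₂ - y 1 • V.σ₁ + V.γin : E →L[ℂ] E).toLinearMap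

/-- The discriminant variety (discriminant curve) `Δ = 0` in the complex affine plane. -/
def VesselData.discriminantVariety {H E : Type*}
    [NormedAddCommGroup H] [InnerProductSpace ℂ H]
    [NormedAddCommGroup E] [InnerProductSpace ℂ E]
    (V : VesselData H E) : Set (Fin 2 → ℂ) :=
  {y | V.discriminant y = 0}

/-! ### Rational transformations, given by `r = (p₁ / p₀, p₂ / p₀)` -/

/-- The maximal degree of `p₀, p₁, p₂`. -/
noncomputable def maxDegree (p : Fin 3 → MvPolynomial (Fin 2) ℝ) : ℕ :=
  Finset.univ.sup fun k => (p k).totalDegree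

/-- The image curve `C' = r(C)`, `C` being the discriminant curve of `V`: the Zariski closure of
the set of all `r(y)`, `y ∈ C`, `p₀(y) ≠ 0`. -/
noncomputable def imageCurve {H E : Type*}
    [NormedAddCommGroup H] [InnerProductSpace ℂ H]
    [NormedAddCommGroup E] [InnerProductSpace ℂ E]
    (V : VesselData H E) (p : Fin 3 → MvPolynomial (Fin 2) ℝ) : Set (Fin 2 → ℂ) :=
  MvPolynomial.zeroLocus ℂ (MvPolynomial.vanishingIdeal ℂ
    {z : Fin 2 → ℂ | ∃ y ∈ V.discriminantVariety, MvPolynomial.aeval y (p 0) ≠ 0 ∧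
      z = ![MvPolynomial.aeval y (p 1) / MvPolynomial.aeval y (p 0),
            MvPolynomial.aeval y (p 2) / MvPolynomial.aeval y (p 0)]})

/-- `p(A₁, A₂)`, for commuting operators `A₁, A₂`. -/
noncomputable def opEval {H : Type*} [NormedAddCommGroup H] [InnerProductSpace ℂ H]
    (p : MvPolynomial (Fin 2) ℝ) (A₁ A₂ : H →L[ℂ] H) : H →L[ℂ] H :=
  ∑ d ∈ p.support, ((p.coeff d : ℝ) : ℂ) • (A₁ ^ d 0 * A₂ ^ d 1)

/-- The homogenization up to degree `n` (`n` at least the degree of `p`):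
`P(x₀, x₁, x₂) = x₀ ^ n p(x₁ / x₀, x₂ / x₀)`. -/
noncomputable def homogenize (n : ℕ) (p : MvPolynomial (Fin 2) ℝ) : MvPolynomial (Fin 3) ℝ :=
  ∑ d ∈ p.support, MvPolynomial.C (p.coeff d) *
    (MvPolynomial.X 0 ^ (n - (d 0 + d 1)) * MvPolynomial.X 1 ^ d 0 * MvPolynomial.X 2 ^ d 1)

/-! ### The blown up space and the principal subspace -/

/-- The exponents `(i₀, i₁, i₂)` with `i₀ + i₁ + i₂ = n - 1`; there are `n (n + 1) / 2` of them
(none if `n = 0`). -/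
abbrev Idx (n : ℕ) : Type := {i : Fin 3 → ℕ // ∑ a, i a + 1 = n}

instance Idx.instFintype (n : ℕ) : Fintype (Idx n) :=
  Fintype.subtype
    ((Fintype.piFinset fun _ : Fin 3 => Finset.range n).filter fun i => ∑ a, i a + 1 = n)
    (fun i => by
      simp only [Finset.mem_filter, Fintype.mem_piFinset, Finset.mem_range, and_iff_right_iff_imp]
      intro h a
      have := Finset.single_le_sum (f := i) (fun _ _ => Nat.zero_le _) (Finset.mem_univ a)
      omega)

/-- The exponent `j + e_a`. -/
def Idx.up {n : ℕ} (j : Fin 3 → ℕ) (hj : ∑ a, j a + 2 = n) (a : Fin 3) : Idx n :=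
  ⟨j + Pi.single a 1, by simp only [Pi.add_apply, Finset.sum_add_distrib]; simp; omega⟩

/-- The blown up space `W_n = ℂ ^ (n (n + 1) / 2) ⊗ E`, with the Hilbert space norm. -/
abbrev BlownSpace (n : ℕ) (E : Type*) [NormedAddCommGroup E] : Type _ :=
  PiLp 2 (fun _ : Idx n => E)

/-- The principal subspace `V_n` of the blown up space, for the determinantal representation
`det (x₀ γⁱⁿ + x₁ σ₂ - x₂ σ₁)`. -/
def VesselData.principalSubspace {H E : Type*}
    [NormedAddCommGroup H] [InnerProductSpace ℂ H]
    [NormedAddCommGroup E] [InnerProductSpace ℂ E]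
    (V : VesselData H E) (n : ℕ) : Submodule ℂ (BlownSpace n E) where
  carrier := {w | ∀ (j : Fin 3 → ℕ) (hj : ∑ a, j a + 2 = n),
    V.γin (w (Idx.up j hj 0)) + V.σ₂ (w (Idx.up j hj 1)) - V.σ₁ (w (Idx.up j hj 2)) = 0}
  zero_mem' := by intro j hj; simp
  add_mem' := by
    intro v w hv hw j hj
    have h := congrArg₂ (· + ·) (hv j hj) (hw j hj)
    simp only [PiLp.add_apply, map_add, add_zero] at h ⊢
    rw [← h]; abel
  smul_mem' := by
    intro c w hw j hj
    have h := congrArg (c • ·) (hw j hj)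
    simp only [PiLp.smul_apply, map_smul, smul_zero, smul_add, smul_sub] at h ⊢
    exact h

/-! ### Generalized Bezout matrices -/

/-- The monomial `x ^ i` in the first triple `x₀, x₁, x₂` of variables. -/
noncomputable def xMonomial (i : Fin 3 → ℕ) : MvPolynomial (Fin 3 ⊕ Fin 3) ℝ :=
  ∏ a, MvPolynomial.X (Sum.inl a) ^ i a

/-- The monomial `y ^ i` in the second triple `y₀, y₁, y₂` of variables. -/
noncomputable def yMonomial (i : Fin 3 → ℕ) : MvPolynomial (Fin 3 ⊕ Fin 3) ℝ :=
  ∏ a, MvPolynomial.X (Sum.inr a) ^ i a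

/-- The polynomial `x_a y_b - x_b y_a`. -/
noncomputable def minor (a b : Fin 3) : MvPolynomial (Fin 3 ⊕ Fin 3) ℝ :=
  MvPolynomial.X (Sum.inl a) * MvPolynomial.X (Sum.inr b) -
    MvPolynomial.X (Sum.inl b) * MvPolynomial.X (Sum.inr a)

/-- The polynomial `P(x) Q(y) - Q(x) P(y)`. -/
noncomputable def bezoutForm (P Q : MvPolynomial (Fin 3) ℝ) : MvPolynomial (Fin 3 ⊕ Fin 3) ℝ :=
  MvPolynomial.rename Sum.inl P * MvPolynomial.rename Sum.inr Q -
    MvPolynomial.rename Sum.inl Q * MvPolynomial.rename Sum.inr P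

/-- Real symmetric matrices `β¹⁰, β²⁰, β¹²` of size `n (n + 1) / 2` that express
`P(x) Q(y) - Q(x) P(y)` through the `x_a y_b - x_b y_a`. -/
structure BezoutTriple (n : ℕ) (P Q : MvPolynomial (Fin 3) ℝ) where
  β₁₀ : Matrix (Idx n) (Idx n) ℝ
  β₂₀ : Matrix (Idx n) (Idx n) ℝ
  β₁₂ : Matrix (Idx n) (Idx n) ℝ
  symm₁₀ : β₁₀.IsSymm
  symm₂₀ : β₂₀.IsSymm
  symm₁₂ : β₁₂.IsSymm
  identity : bezoutForm P Q =
    ∑ i : Idx n, ∑ j : Idx n,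
      (MvPolynomial.C (β₁₀ i j) * xMonomial i * minor 1 0 * yMonomial j +
       MvPolynomial.C (β₂₀ i j) * xMonomial i * minor 2 0 * yMonomial j +
       MvPolynomial.C (β₁₂ i j) * xMonomial i * minor 1 2 * yMonomial j)

/-- The homogenization is homogeneous. -/
theorem homogenize_isHomogeneous {n : ℕ} {p : MvPolynomial (Fin 2) ℝ} (hp : p.totalDegree ≤ n) :
    (homogenize n p).IsHomogeneous n := by
  refine MvPolynomial.IsHomogeneous.sum _ _ _ fun d hd => ?_
  have hd' : d 0 + d 1 ≤ n := by
    refine le_trans ?_ hp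
    have h := MvPolynomial.le_totalDegree hd
    rwa [Finsupp.sum_fintype _ _ (fun _ => rfl), Fin.sum_univ_two] at h
  have h := (((MvPolynomial.isHomogeneous_X_pow (R := ℝ) (0 : Fin 3) (n - (d 0 + d 1))).mul
    (MvPolynomial.isHomogeneous_X_pow 1 (d 0))).mul
    (MvPolynomial.isHomogeneous_X_pow 2 (d 1))).C_mul (p.coeff d)
  have e : n - (d 0 + d 1) + d 0 + d 1 = n := by omega
  rwa [e] at h

/-- The span of the polynomials `(x ^ i y ^ j + x ^ j y ^ i) m` with `m` one of the
`x_a y_b - x_b y_a`. -/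
noncomputable def bezoutSpan (n : ℕ) : Submodule ℝ (MvPolynomial (Fin 3 ⊕ Fin 3) ℝ) :=
  Submodule.span ℝ {F | ∃ (i j : Idx n) (a b : Fin 3),
    F = (xMonomial i * yMonomial j + xMonomial j * yMonomial i) * minor a b}

theorem xMonomial_up (i : Fin 3 → ℕ) (a : Fin 3) :
    xMonomial (i + Pi.single a 1) = xMonomial i * MvPolynomial.X (Sum.inl a) := by
  simp only [xMonomial, Pi.add_apply, pow_add, Finset.prod_mul_distrib]
  congr 1
  rw [Finset.prod_eq_single a (by intro b _ hb; simp [Pi.single_eq_of_ne hb]) (by simp)]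
  simp

theorem yMonomial_up (i : Fin 3 → ℕ) (a : Fin 3) :
    yMonomial (i + Pi.single a 1) = yMonomial i * MvPolynomial.X (Sum.inr a) := by
  simp only [yMonomial, Pi.add_apply, pow_add, Finset.prod_mul_distrib]
  congr 1
  rw [Finset.prod_eq_single a (by intro b _ hb; simp [Pi.single_eq_of_ne hb]) (by simp)]
  simp

theorem mul_mem_bezoutSpan {n : ℕ} (a b : Fin 3) {F : MvPolynomial (Fin 3 ⊕ Fin 3) ℝ}
    (hF : F ∈ bezoutSpan n) :
    (MvPolynomial.X (Sum.inl a) * MvPolynomial.X (Sum.inr b) +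
      MvPolynomial.X (Sum.inl b) * MvPolynomial.X (Sum.inr a)) * F ∈ bezoutSpan (n + 1) := by
  have hs : ∀ (i : Idx n) (c : Fin 3), ∑ k, (i.1 + Pi.single c 1 : Fin 3 → ℕ) k + 1 = n + 1 := by
    intro i c
    have := i.2
    simp only [Pi.add_apply, Finset.sum_add_distrib, Finset.sum_pi_single', Finset.mem_univ]
    simp; omega
  induction hF using Submodule.span_induction with
  | zero => simp
  | add F G _ _ hF hG => rw [mul_add]; exact add_mem hF hG
  | smul c F _ hF => rw [mul_smul_comm]; exact Submodule.smul_mem _ _ hF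
  | mem F hF =>
    obtain ⟨i, j, c, d, rfl⟩ := hF
    have h₁ : _ ∈ bezoutSpan (n + 1) := Submodule.subset_span
      ⟨⟨_, hs i a⟩, ⟨_, hs j b⟩, c, d, rfl⟩
    have h₂ : _ ∈ bezoutSpan (n + 1) := Submodule.subset_span
      ⟨⟨_, hs i b⟩, ⟨_, hs j a⟩, c, d, rfl⟩
    convert add_mem h₁ h₂ using 1
    simp only [xMonomial_up, yMonomial_up]
    ring

theorem monomial_mem_bezoutSpan (n : ℕ) : ∀ (i j : Fin 3 → ℕ), ∑ a, i a = n → ∑ a, j a = n →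
    xMonomial i * yMonomial j - xMonomial j * yMonomial i ∈ bezoutSpan n := by
  induction n with
  | zero =>
    intro i j hi hj
    have hi' : i = 0 := by funext a; simpa using (Finset.sum_eq_zero_iff.1 hi) a (Finset.mem_univ a)
    have hj' : j = 0 := by funext a; simpa using (Finset.sum_eq_zero_iff.1 hj) a (Finset.mem_univ a)
    subst hi' hj'
    simp
  | succ n ih =>
    have key : ∀ i : Fin 3 → ℕ, ∑ a, i a = n + 1 →
        ∃ (a : Fin 3) (i' : Fin 3 → ℕ), i = i' + Pi.single a 1 ∧ ∑ c, i' c = n := by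
      intro i hi
      obtain ⟨a, -, ha⟩ := Finset.exists_ne_zero_of_sum_ne_zero (s := Finset.univ) (f := i)
        (by omega)
      have e : i = (i - Pi.single a 1) + Pi.single a 1 := by
        funext c
        by_cases hc : c = a
        · subst hc; simp; omega
        · simp [Pi.single_eq_of_ne hc]
      refine ⟨a, i - Pi.single a 1, e, ?_⟩
      have h := hi
      rw [e] at h
      simp only [Pi.add_apply, Finset.sum_add_distrib] at h
      simp at h
      simpa using h
    intro i j hi hj
    obtain ⟨a, i', rfl, hi'⟩ := key i hi
    obtain ⟨b, j', rfl, hj'⟩ := key j hj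
    have h₁ : _ ∈ bezoutSpan (n + 1) := Submodule.subset_span
      ⟨⟨i', by omega⟩, ⟨j', by omega⟩, a, b, rfl⟩
    have h₂ := mul_mem_bezoutSpan a b (ih i' j' hi' hj')
    convert Submodule.smul_mem _ (1 / 2 : ℝ) (add_mem h₁ h₂) using 1
    simp only [xMonomial_up, yMonomial_up, minor, MvPolynomial.smul_eq_C_mul]
    have hc : (MvPolynomial.C (1 / 2 : ℝ) : MvPolynomial (Fin 3 ⊕ Fin 3) ℝ) * 2 = 1 := by
      rw [show (2 : MvPolynomial (Fin 3 ⊕ Fin 3) ℝ) = MvPolynomial.C 2 from (map_ofNat _ 2).symm,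
        ← MvPolynomial.C_mul]
      norm_num
    linear_combination (-(xMonomial i' * MvPolynomial.X (Sum.inl a) *
      (yMonomial j' * MvPolynomial.X (Sum.inr b)) - xMonomial j' * MvPolynomial.X (Sum.inl b) *
      (yMonomial i' * MvPolynomial.X (Sum.inr a)))) * hc

theorem bezoutForm_mem_bezoutSpan {n : ℕ} {P Q : MvPolynomial (Fin 3) ℝ}
    (hP : P.IsHomogeneous n) (hQ : Q.IsHomogeneous n) : bezoutForm P Q ∈ bezoutSpan n := by
  have hx : ∀ P : MvPolynomial (Fin 3) ℝ, MvPolynomial.rename (Sum.inl : _ → Fin 3 ⊕ Fin 3) P =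
      ∑ d ∈ P.support, P.coeff d • xMonomial d := by
    intro P
    conv_lhs => rw [P.as_sum]
    simp only [map_sum]
    refine Finset.sum_congr rfl fun d _ => ?_
    rw [MvPolynomial.monomial_eq, map_mul, MvPolynomial.rename_C, MvPolynomial.smul_eq_C_mul,
      Finsupp.prod_fintype _ _ (fun _ => pow_zero _), map_prod, xMonomial]
    simp
  have hy : ∀ P : MvPolynomial (Fin 3) ℝ, MvPolynomial.rename (Sum.inr : _ → Fin 3 ⊕ Fin 3) P =
      ∑ d ∈ P.support, P.coeff d • yMonomial d := by
    intro P
    conv_lhs => rw [P.as_sum]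
    simp only [map_sum]
    refine Finset.sum_congr rfl fun d _ => ?_
    rw [MvPolynomial.monomial_eq, map_mul, MvPolynomial.rename_C, MvPolynomial.smul_eq_C_mul,
      Finsupp.prod_fintype _ _ (fun _ => pow_zero _), map_prod, yMonomial]
    simp
  have hdeg : ∀ {P : MvPolynomial (Fin 3) ℝ}, P.IsHomogeneous n → ∀ d ∈ P.support,
      ∑ a, d a = n := by
    intro P hP d hd
    have := hP (MvPolynomial.mem_support_iff.1 hd)
    rw [Finsupp.weight_apply, Finsupp.sum_fintype _ _ (fun _ => by simp)] at this
    simpa using this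
  have e : bezoutForm P Q = ∑ d ∈ P.support, ∑ f ∈ Q.support, (P.coeff d * Q.coeff f) •
      (xMonomial d * yMonomial f - xMonomial f * yMonomial d) := by
    rw [bezoutForm, hx, hy, hx, hy, Finset.sum_mul_sum, Finset.sum_mul_sum,
      Finset.sum_comm (s := Q.support), ← Finset.sum_sub_distrib]
    refine Finset.sum_congr rfl fun d _ => ?_
    rw [← Finset.sum_sub_distrib]
    refine Finset.sum_congr rfl fun f _ => ?_
    rw [smul_mul_smul_comm, smul_mul_smul_comm, smul_sub, mul_comm (P.coeff d)]
  rw [e]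
  exact Submodule.sum_mem _ fun d hd => Submodule.sum_mem _ fun f hf => Submodule.smul_mem _ _
    (monomial_mem_bezoutSpan n d f (hdeg hP d hd) (hdeg hQ f hf))

/-- Bezout matrices exist for every pair of homogeneous polynomials of degree `n`. -/
theorem BezoutTriple.nonempty {n : ℕ} {P Q : MvPolynomial (Fin 3) ℝ}
    (hP : P.IsHomogeneous n) (hQ : Q.IsHomogeneous n) : Nonempty (BezoutTriple n P Q) := by
  suffices h : ∀ F ∈ bezoutSpan n, ∃ β₁₀ β₂₀ β₁₂ : Matrix (Idx n) (Idx n) ℝ,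
      β₁₀.IsSymm ∧ β₂₀.IsSymm ∧ β₁₂.IsSymm ∧
      F = ∑ i : Idx n, ∑ j : Idx n,
        (MvPolynomial.C (β₁₀ i j) * xMonomial i * minor 1 0 * yMonomial j +
         MvPolynomial.C (β₂₀ i j) * xMonomial i * minor 2 0 * yMonomial j +
         MvPolynomial.C (β₁₂ i j) * xMonomial i * minor 1 2 * yMonomial j) by
    obtain ⟨β₁₀, β₂₀, β₁₂, h₁, h₂, h₃, h⟩ := h _ (bezoutForm_mem_bezoutSpan hP hQ)
    exact ⟨⟨β₁₀, β₂₀, β₁₂, h₁, h₂, h₃, h⟩⟩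
  intro F hF
  induction hF using Submodule.span_induction with
  | zero => exact ⟨0, 0, 0, Matrix.transpose_zero, Matrix.transpose_zero, Matrix.transpose_zero,
      by simp⟩
  | add F G _ _ hF hG =>
    obtain ⟨b₁, b₂, b₃, h₁, h₂, h₃, h⟩ := hF
    obtain ⟨c₁, c₂, c₃, k₁, k₂, k₃, k⟩ := hG
    refine ⟨b₁ + c₁, b₂ + c₂, b₃ + c₃, h₁.add k₁, h₂.add k₂, h₃.add k₃, ?_⟩
    rw [h, k, ← Finset.sum_add_distrib]
    refine Finset.sum_congr rfl fun i _ => ?_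
    rw [← Finset.sum_add_distrib]
    refine Finset.sum_congr rfl fun j _ => ?_
    simp only [Matrix.add_apply, MvPolynomial.C_add]
    ring
  | smul c F _ hF =>
    obtain ⟨b₁, b₂, b₃, h₁, h₂, h₃, h⟩ := hF
    refine ⟨c • b₁, c • b₂, c • b₃, h₁.smul c, h₂.smul c, h₃.smul c, ?_⟩
    rw [h, Finset.smul_sum]
    refine Finset.sum_congr rfl fun i _ => ?_
    rw [Finset.smul_sum]
    refine Finset.sum_congr rfl fun j _ => ?_
    simp only [Matrix.smul_apply, smul_eq_mul, MvPolynomial.C_mul, MvPolynomial.smul_eq_C_mul]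
    ring
  | mem F hF =>
    obtain ⟨i, j, a, b, rfl⟩ := hF
    classical
    have hm : ∃ u v w : ℝ, minor a b = MvPolynomial.C u * minor 1 0 + MvPolynomial.C v * minor 2 0 +
        MvPolynomial.C w * minor 1 2 := by
      fin_cases a <;> fin_cases b
      · exact ⟨0, 0, 0, by simp [minor]⟩
      · exact ⟨-1, 0, 0, by simp [minor]⟩
      · exact ⟨0, -1, 0, by simp [minor]⟩
      · exact ⟨1, 0, 0, by simp [minor]⟩
      · exact ⟨0, 0, 0, by simp [minor]⟩
      · exact ⟨0, 0, 1, by simp [minor]⟩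
      · exact ⟨0, 1, 0, by simp [minor]⟩
      · exact ⟨0, 0, -1, by simp [minor]⟩
      · exact ⟨0, 0, 0, by simp [minor]⟩
    obtain ⟨u, v, w, hm⟩ := hm
    let S : Matrix (Idx n) (Idx n) ℝ := Matrix.single i j 1 + Matrix.single j i 1
    have hS : S.IsSymm := by
      simp [S, Matrix.IsSymm, Matrix.transpose_add, Matrix.transpose_single, add_comm]
    have hsum : ∀ G : MvPolynomial (Fin 3 ⊕ Fin 3) ℝ, ∑ k : Idx n, ∑ l : Idx n,
        MvPolynomial.C (S k l) * (xMonomial k * yMonomial l * G) =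
        (xMonomial i * yMonomial j + xMonomial j * yMonomial i) * G := by
      intro G
      have h1 : ∀ i j : Idx n, ∑ k : Idx n, ∑ l : Idx n,
          MvPolynomial.C ((Matrix.single i j (1 : ℝ) : Matrix (Idx n) (Idx n) ℝ) k l) *
            (xMonomial k * yMonomial l * G) = xMonomial i * yMonomial j * G := by
        intro i j
        rw [Finset.sum_eq_single i, Finset.sum_eq_single j]
        · simp
        · intro l _ hl; simp [Matrix.single, hl.symm]
        · simp
        · intro k _ hk; refine Finset.sum_eq_zero fun l _ => ?_
          simp [Matrix.single, hk.symm]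
        · simp
      simp only [S, Matrix.add_apply, MvPolynomial.C_add, add_mul, Finset.sum_add_distrib, h1]
    refine ⟨u • S, v • S, w • S, hS.smul u, hS.smul v, hS.smul w, ?_⟩
    rw [hm, ← hsum]
    refine Finset.sum_congr rfl fun k _ => Finset.sum_congr rfl fun l _ => ?_
    simp only [Matrix.smul_apply, smul_eq_mul, MvPolynomial.C_mul]
    ring

/-- The operator `β ⊗ D` on the blown up space. -/
noncomputable def tensorOp {n : ℕ} {E : Type*} [NormedAddCommGroup E] [InnerProductSpace ℂ E]
    (β : Matrix (Idx n) (Idx n) ℝ) (D : E →L[ℂ] E) : BlownSpace n E →L[ℂ] BlownSpace n E :=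
  (PiLp.continuousLinearEquiv 2 ℂ (fun _ : Idx n => E)).symm.toContinuousLinearMap ∘L
    ContinuousLinearMap.pi fun i => ∑ j, (β i j : ℂ) • (D ∘L PiLp.proj 2 (fun _ : Idx n => E) j)

/-- The Bezout matrix along the discriminant curve: the compression of
`B(P, Q) = β¹² ⊗ γⁱⁿ + β¹⁰ ⊗ σ₁ + β²⁰ ⊗ σ₂` to the principal subspace. -/
noncomputable def VesselData.bezout {H E : Type*}
    [NormedAddCommGroup H] [InnerProductSpace ℂ H]
    [NormedAddCommGroup E] [InnerProductSpace ℂ E] [FiniteDimensional ℂ E]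
    (V : VesselData H E) {n : ℕ} {P Q : MvPolynomial (Fin 3) ℝ} (b : BezoutTriple n P Q) :
    V.principalSubspace n →L[ℂ] V.principalSubspace n :=
  (V.principalSubspace n).orthogonalProjectionOnto ∘L
    (tensorOp b.β₁₂ V.γin + tensorOp b.β₁₀ V.σ₁ + tensorOp b.β₂₀ V.σ₂) ∘L
    (V.principalSubspace n).subtypeL

/-! ### The transformed vessel -/

open ContinuousLinearMap in
/-- `Φ'`: the projection to `E' = V_n` of the family
`Φ A₁*^{i₁} A₂*^{i₂} p₀(A₁*, A₂*)⁻¹`, `i₀ + i₁ + i₂ = n - 1`. -/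
noncomputable def VesselData.transformΦ {H E : Type*}
    [NormedAddCommGroup H] [InnerProductSpace ℂ H] [CompleteSpace H]
    [NormedAddCommGroup E] [InnerProductSpace ℂ E] [FiniteDimensional ℂ E]
    (V : VesselData H E) (n : ℕ) (p₀ : MvPolynomial (Fin 2) ℝ) :
    H →L[ℂ] V.principalSubspace n :=
  (V.principalSubspace n).orthogonalProjectionOnto ∘L
    (PiLp.continuousLinearEquiv 2 ℂ (fun _ : Idx n => E)).symm.toContinuousLinearMap ∘L
    ContinuousLinearMap.pi fun i : Idx n =>
      V.Φ ∘L (adjoint V.A₁ ^ i.1 1 * adjoint V.A₂ ^ i.1 2 *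
        Ring.inverse (opEval p₀ (adjoint V.A₁) (adjoint V.A₂)))

open ContinuousLinearMap in
/-- The transformed vessel `V' = (A₁', A₂', H, Φ', E', σ₁', σ₂', γ'ⁱⁿ, γ'ᵒᵘᵗ)` with `E' = V_n`,
where `σ₁', σ₂', γ'ⁱⁿ` are the Bezout matrices along the curve of the pairs
`(P₁, P₀)`, `(P₂, P₀)`, `(P₁, P₂)`, and `P₀, P₁, P₂` are the homogenizations of `p₀, p₁, p₂`
up to their maximal degree `n`. -/
noncomputable def VesselData.transform {H E : Type*}
    [NormedAddCommGroup H] [InnerProductSpace ℂ H] [CompleteSpace H]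
    [NormedAddCommGroup E] [InnerProductSpace ℂ E] [FiniteDimensional ℂ E]
    (V : VesselData H E) (p : Fin 3 → MvPolynomial (Fin 2) ℝ)
    (b₁₀ : BezoutTriple (maxDegree p)
      (homogenize (maxDegree p) (p 1)) (homogenize (maxDegree p) (p 0)))
    (b₂₀ : BezoutTriple (maxDegree p)
      (homogenize (maxDegree p) (p 2)) (homogenize (maxDegree p) (p 0)))
    (b₁₂ : BezoutTriple (maxDegree p)
      (homogenize (maxDegree p) (p 1)) (homogenize (maxDegree p) (p 2))) :
    VesselData H (V.principalSubspace (maxDegree p)) where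
  A₁ := opEval (p 1) V.A₁ V.A₂ * Ring.inverse (opEval (p 0) V.A₁ V.A₂)
  A₂ := opEval (p 2) V.A₁ V.A₂ * Ring.inverse (opEval (p 0) V.A₁ V.A₂)
  Φ := V.transformΦ (maxDegree p) (p 0)
  σ₁ := V.bezout b₁₀
  σ₂ := V.bezout b₂₀
  γin := V.bezout b₁₂
  γout := V.bezout b₁₂ + Complex.I •
    (V.bezout b₁₀ ∘L V.transformΦ (maxDegree p) (p 0) ∘L
        adjoint (V.transformΦ (maxDegree p) (p 0)) ∘L V.bezout b₂₀ -
      V.bezout b₂₀ ∘L V.transformΦ (maxDegree p) (p 0) ∘L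
        adjoint (V.transformΦ (maxDegree p) (p 0)) ∘L V.bezout b₁₀)

/-! ### Polynomials in three variables -/

section Polynomials

open MvPolynomial

/-! Let `y` lie on the discriminant variety of `V` with `p₀(y) ≠ 0`, let `u ≠ 0` be a kernel vector
there, put `c = (1, y 0, y 1)` and `z = r(y)`. The vector `w = (cⁱ u)ᵢ` is a nonzero element of
`V_n`, and it is a kernel vector of `z₁ σ₂' - z₂ σ₁' + γ'ⁱⁿ`.

To see this, read a vector `v` of the blown up space as a functional on `polynomials ⊗ E`.
Eliminating `γⁱⁿ u`, the inner product of `v` with the uncompressed combination applied to `w`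
becomes the value of `v` on `a ⊗ σ₁ u + b ⊗ σ₂ u`, with `a`, `b` built from rows of the Bezout
matrices. Setting the second triple of variables to `c` in the Bezout identities
(`BezoutTriple.specialize_identity`) gives `(X₁ - c₁ X₀) a + (X₂ - c₂ X₀) b = 0`, because `P_k(c) =
z_k P₀(c)`. By `exists_koszul_factor` there is a `q` with `a = (X₂ - c₂ X₀) q` and `b = -(X₁ - c₁
X₀) q`, so the tensor equals `-(X₀ γⁱⁿ + X₁ σ₂ - X₂ σ₁)(q ⊗ u)`, which every `v ∈ V_n` annihilates
(`blownPairing_principalSubspace`).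

Thus `r(y)` lies on the new variety. That variety is the zero set of a polynomial, so it contains
the Zariski closure too. -/

/-- A syzygy of the two linear forms `X₁ - y₁ X₀` and `X₂ - y₂ X₀` is a multiple of the Koszul one. -/
theorem exists_koszul_factor {y₁ y₂ : ℂ} {a b : MvPolynomial (Fin 3) ℂ}
    (h : (X 1 - C y₁ * X 0) * a + (X 2 - C y₂ * X 0) * b = 0) :
    ∃ q, a = (X 2 - C y₂ * X 0) * q ∧ b = -((X 1 - C y₁ * X 0) * q) := by
  -- Reduction modulo `X₂ - y₂ X₀`. It fixes `X₁ - y₁ X₀`, which is nonzero, so the relation forces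
  -- `φ a = 0` in a domain.
  let φ : MvPolynomial (Fin 3) ℂ →ₐ[ℂ] MvPolynomial (Fin 3) ℂ :=
    aeval ![X 0, X 1, C y₂ * X 0]
  have hdvd : ∀ f, (X 2 - C y₂ * X 0) ∣ f - φ f := by
    intro f
    induction f using MvPolynomial.induction_on with
    | C c => simp [φ, MvPolynomial.algebraMap_eq]
    | add f g hf hg =>
      rw [map_add, add_sub_add_comm]
      exact dvd_add hf hg
    | mul_X f k hf =>
      rw [map_mul, show f * X k - φ f * φ (X k) = (f - φ f) * X k + φ f * (X k - φ (X k)) by ring]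
      refine dvd_add (hf.mul_right _) (Dvd.dvd.mul_left ?_ _)
      fin_cases k <;> simp [φ]
  have hs : (X 1 - C y₁ * X 0 : MvPolynomial (Fin 3) ℂ) ≠ 0 := by
    intro h0
    have := congrArg (eval ![0, 1, 0]) h0
    simp at this
  have ht : (X 2 - C y₂ * X 0 : MvPolynomial (Fin 3) ℂ) ≠ 0 := by
    intro h0
    have := congrArg (eval ![0, 0, 1]) h0
    simp at this
  have hφa : φ a = 0 := by
    have h1 := congrArg φ h
    have e0 : φ (X 0) = X 0 := by simp [φ]
    have e1 : φ (X 1) = X 1 := by simp [φ]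
    have e2 : φ (X 2) = C y₂ * X 0 := by simp [φ]
    have ec : ∀ c, φ (C c) = C c := fun c => φ.commutes c
    simp only [map_add, map_mul, map_sub, map_zero, e0, e1, e2, ec, sub_self, zero_mul,
      add_zero] at h1
    exact (mul_eq_zero.1 h1).resolve_left hs
  obtain ⟨q, hq⟩ := hdvd a
  rw [hφa, sub_zero] at hq
  refine ⟨q, hq, ?_⟩
  apply mul_left_cancel₀ ht
  rw [hq] at h
  linear_combination h

theorem aeval_homogenize (n : ℕ) (p : MvPolynomial (Fin 2) ℝ) (y : Fin 2 → ℂ) :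
    aeval ![1, y 0, y 1] (homogenize n p) = aeval y p := by
  rw [homogenize, map_sum]
  conv_rhs => rw [p.as_sum, map_sum]
  refine Finset.sum_congr rfl fun d _ => ?_
  rw [aeval_monomial, Finsupp.prod_fintype _ _ (fun _ => pow_zero _), Fin.prod_univ_two]
  simp

/-- The specialization `x ↦ X`, `y ↦ c` of polynomials in two triples of variables. -/
noncomputable def specialize (c : Fin 3 → ℂ) :
    MvPolynomial (Fin 3 ⊕ Fin 3) ℝ →ₐ[ℝ] MvPolynomial (Fin 3) ℂ :=
  aeval (Sum.elim X fun a => C (c a))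

theorem specialize_rename_inl (c : Fin 3 → ℂ) (P : MvPolynomial (Fin 3) ℝ) :
    specialize c (rename Sum.inl P) = aeval X P := by
  rw [specialize, aeval_rename]; rfl

theorem specialize_rename_inr (c : Fin 3 → ℂ) (P : MvPolynomial (Fin 3) ℝ) :
    specialize c (rename Sum.inr P) = C (aeval c P) := by
  -- Both sides are `ℝ`-algebra maps, so comparing them on the variables suffices.
  have h : (specialize c).comp (rename Sum.inr) =
      ((Algebra.ofId ℂ (MvPolynomial (Fin 3) ℂ)).restrictScalars ℝ).comp (aeval c) := by
    ext a
    simp [specialize, Algebra.ofId_apply, MvPolynomial.algebraMap_eq]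
  simpa [Algebra.ofId_apply, MvPolynomial.algebraMap_eq] using DFunLike.congr_fun h P

/-- The polynomial `∑ βᵢⱼ cʲ Xⁱ`. -/
noncomputable def bezoutRow {n : ℕ} (β : Matrix (Idx n) (Idx n) ℝ) (c : Fin 3 → ℂ) :
    MvPolynomial (Fin 3) ℂ :=
  ∑ i : Idx n, monomial (Finsupp.equivFunOnFinite.symm i.1) (∑ j : Idx n, (β i j : ℂ) *
    ∏ a, c a ^ j.1 a)

/-- The minor does not involve `i`, `j`, so it comes out of the double sum; once `y = c`, the sum
over `j` collapses to a coefficient of the row polynomial. -/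
theorem specialize_sum_mul {n : ℕ} (β : Matrix (Idx n) (Idx n) ℝ) (c : Fin 3 → ℂ) (a b : Fin 3) :
    specialize c (∑ i : Idx n, ∑ j : Idx n, C (β i j) * xMonomial i * minor a b * yMonomial j) =
      (X a * C (c b) - X b * C (c a)) * bezoutRow β c := by
  have hC : ∀ r : ℝ, specialize c (C r) = C (r : ℂ) := fun r => (specialize c).commutes r
  have hl : ∀ a, specialize c (X (Sum.inl a)) = X a := fun a => by simp [specialize]
  have hr : ∀ a, specialize c (X (Sum.inr a)) = C (c a) := fun a => by simp [specialize]
  simp only [bezoutRow, map_sum, Finset.mul_sum]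
  refine Finset.sum_congr rfl fun i _ => Finset.sum_congr rfl fun j _ => ?_
  simp only [xMonomial, yMonomial, minor, map_mul, map_sub, map_prod, map_pow, hC, hl, hr,
    monomial_eq, Finsupp.prod_fintype _ _ (fun _ => pow_zero _),
    Finsupp.coe_equivFunOnFinite_symm]
  ring

theorem BezoutTriple.specialize_identity {n : ℕ} {P Q : MvPolynomial (Fin 3) ℝ}
    (b : BezoutTriple n P Q) (c : Fin 3 → ℂ) :
    aeval X P * C (aeval c Q) - aeval X Q * C (aeval c P) =
      (X 1 * C (c 0) - X 0 * C (c 1)) * bezoutRow b.β₁₀ c +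
      (X 2 * C (c 0) - X 0 * C (c 2)) * bezoutRow b.β₂₀ c +
      (X 1 * C (c 2) - X 2 * C (c 1)) * bezoutRow b.β₁₂ c := by
  have h := congrArg (specialize c) b.identity
  simp only [Finset.sum_add_distrib, map_add, specialize_sum_mul] at h
  rw [← h, bezoutForm]
  simp only [map_sub, map_mul, specialize_rename_inl, specialize_rename_inr]

end Polynomials

/-! ### Vectors of the blown up space as functionals on polynomials -/

section Pairing

variable {n : ℕ} {E : Type*} [NormedAddCommGroup E] [InnerProductSpace ℂ E]

/-- The pairing `∑ fᵢ ⟪vᵢ, e⟫` of a vector `v` of the blown up space with `f ⊗ e`. -/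
noncomputable def blownPairing (v : BlownSpace n E) (e : E) :
    MvPolynomial (Fin 3) ℂ →ₗ[ℂ] ℂ :=
  ∑ i : Idx n, inner ℂ (v i) e • MvPolynomial.lcoeff ℂ (Finsupp.equivFunOnFinite.symm i.1)

theorem blownPairing_apply (v : BlownSpace n E) (e : E) (f : MvPolynomial (Fin 3) ℂ) :
    blownPairing v e f =
      ∑ i : Idx n, inner ℂ (v i) e * f.coeff (Finsupp.equivFunOnFinite.symm i.1) := by
  simp [blownPairing]

theorem blownPairing_sub (v : BlownSpace n E) (e e' : E) (f : MvPolynomial (Fin 3) ℂ) :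
    blownPairing v (e - e') f = blownPairing v e f - blownPairing v e' f := by
  simp only [blownPairing_apply, inner_sub_right, sub_mul, Finset.sum_sub_distrib]

theorem blownPairing_smul (v : BlownSpace n E) (r : ℂ) (e : E) (f : MvPolynomial (Fin 3) ℂ) :
    blownPairing v (r • e) f = r * blownPairing v e f := by
  simp only [blownPairing_apply, inner_smul_right, mul_assoc, Finset.mul_sum]

theorem blownPairing_monomial (v : BlownSpace n E) (e : E) (i : Idx n) (r : ℂ) :
    blownPairing v e (MvPolynomial.monomial (Finsupp.equivFunOnFinite.symm i.1) r) =
      inner ℂ (v i) e * r := by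
  rw [blownPairing_apply, Finset.sum_eq_single i]
  · simp
  · intro k _ hk
    rw [MvPolynomial.coeff_monomial, if_neg, mul_zero]
    intro h
    exact hk (Subtype.ext (Finsupp.equivFunOnFinite.symm.injective h)).symm
  · simp

/-- The functional sees only degree `n - 1`. Hence the Koszul quotient `q` need not be shown
homogeneous. -/
theorem blownPairing_monomial_of_ne (v : BlownSpace n E) (e : E) (d : Fin 3 →₀ ℕ) (r : ℂ)
    (hd : ∑ a, d a + 1 ≠ n) : blownPairing v e (MvPolynomial.monomial d r) = 0 := by
  rw [blownPairing_apply]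
  refine Finset.sum_eq_zero fun k _ => ?_
  rw [MvPolynomial.coeff_monomial, if_neg, mul_zero]
  rintro rfl
  exact hd k.2

/-- The bridge from operators to polynomials: component `i` of `β ⊗ D` on `(cʲ u)ⱼ` is `D u` times
the coefficient of `Xⁱ` in the row polynomial. -/
theorem blownPairing_bezoutRow (v : BlownSpace n E) (β : Matrix (Idx n) (Idx n) ℝ)
    (D : E →L[ℂ] E) (c : Fin 3 → ℂ) (u : E) :
    inner ℂ v (tensorOp β D (WithLp.toLp 2 fun i : Idx n => (∏ a, c a ^ i.1 a) • u)) =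
      blownPairing v (D u) (bezoutRow β c) := by
  rw [bezoutRow, map_sum, PiLp.inner_apply]
  refine Finset.sum_congr rfl fun i _ => ?_
  have h : (tensorOp β D (WithLp.toLp 2 fun i : Idx n => (∏ a, c a ^ i.1 a) • u)) i =
      (∑ j : Idx n, (β i j : ℂ) * ∏ a, c a ^ j.1 a) • D u := by
    simp [tensorOp, Finset.sum_smul, mul_smul]
  rw [blownPairing_monomial, h, inner_smul_right, mul_comm]

variable {H : Type*} [NormedAddCommGroup H] [InnerProductSpace ℂ H] [CompleteSpace E]

/-- Vectors of the principal subspace annihilate the image of `X₀ γⁱⁿ + X₁ σ₂ - X₂ σ₁`. -/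
theorem blownPairing_principalSubspace (V : VesselData H E) (h₁ : IsSelfAdjoint V.σ₁)
    (h₂ : IsSelfAdjoint V.σ₂) (h₃ : IsSelfAdjoint V.γin) {v : BlownSpace n E}
    (hv : v ∈ V.principalSubspace n) (e : E) (q : MvPolynomial (Fin 3) ℂ) :
    blownPairing v (V.γin e) (MvPolynomial.X 0 * q) +
      blownPairing v (V.σ₂ e) (MvPolynomial.X 1 * q) -
      blownPairing v (V.σ₁ e) (MvPolynomial.X 2 * q) = 0 := by
  induction q using MvPolynomial.induction_on' with
  | add f g hf hg =>
    simp only [mul_add, map_add]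
    linear_combination hf + hg
  | monomial d r =>
    have hX : ∀ a : Fin 3, MvPolynomial.X a * MvPolynomial.monomial d r =
        MvPolynomial.monomial (d + Finsupp.single a 1) r := by
      intro a
      rw [mul_comm, MvPolynomial.monomial_add_single, pow_one]
    -- In degree `n - 2` this is the defining relation of `V_n` at `d`, with the selfadjoint
    -- operators moved across the inner product; in any other degree all three terms vanish.
    by_cases hd : ∑ a, d a + 2 = n
    · have hup : ∀ a, d + Finsupp.single a 1 =
          Finsupp.equivFunOnFinite.symm (Idx.up d hd a).1 := by
        intro a
        ext k
        simp [Idx.up, Finsupp.single_apply, Pi.single_apply, eq_comm]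
      have hsa : ∀ {D : E →L[ℂ] E}, IsSelfAdjoint D → ∀ x, inner ℂ x (D e) = inner ℂ (D x) e :=
        fun hD x => (hD.isSymmetric x e).symm
      have h := congrArg (fun x => inner ℂ x e) (hv d hd)
      simp only [inner_add_left, inner_sub_left, inner_zero_left] at h
      simp only [hX, hup, blownPairing_monomial, hsa h₁, hsa h₂, hsa h₃]
      linear_combination r * h
    · have hne : ∀ a, ∑ k, (d + Finsupp.single a 1 : Fin 3 →₀ ℕ) k + 1 ≠ n := by
        intro a
        have hs : ∑ k, (Finsupp.single a 1 : Fin 3 →₀ ℕ) k = 1 := by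
          simp [Finsupp.single_apply]
        simp only [Finsupp.add_apply, Finset.sum_add_distrib, hs]
        omega
      simp only [hX, blownPairing_monomial_of_ne _ _ _ _ (hne _), add_zero, sub_zero]

end Pairing

/-! ### The discriminant variety of the transformed vessel -/

/-- The discriminant of a vessel is a polynomial function. -/
theorem VesselData.exists_discriminant_eq_aeval {H E : Type*}
    [NormedAddCommGroup H] [InnerProductSpace ℂ H]
    [NormedAddCommGroup E] [InnerProductSpace ℂ E] [FiniteDimensional ℂ E]
    (V : VesselData H E) :
    ∃ F : MvPolynomial (Fin 2) ℂ, ∀ y, V.discriminant y = MvPolynomial.aeval y F := by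
  classical
  let b := Module.finBasis ℂ E
  let M : (E →L[ℂ] E) → Matrix _ _ ℂ := fun D => LinearMap.toMatrix b b D.toLinearMap
  -- The matrix of the pencil with polynomial entries; evaluation commutes with the determinant.
  let N : Matrix (Fin (Module.finrank ℂ E)) (Fin (Module.finrank ℂ E)) (MvPolynomial (Fin 2) ℂ) :=
    (MvPolynomial.X 0 : MvPolynomial (Fin 2) ℂ) • (M V.σ₂).map MvPolynomial.C -
      (MvPolynomial.X 1 : MvPolynomial (Fin 2) ℂ) • (M V.σ₁).map MvPolynomial.C + (M V.γin).map MvPolynomial.C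
  refine ⟨N.det, fun y => ?_⟩
  rw [VesselData.discriminant, ← LinearMap.det_toMatrix b, AlgHom.map_det]
  congr 1
  ext i j
  simp [M, N]

/-- A nonzero vector killed weakly by `y₁ σ₂ - y₂ σ₁ + γⁱⁿ` puts `y` on the discriminant variety. -/
theorem VesselData.discriminant_eq_zero_of_inner {H E : Type*}
    [NormedAddCommGroup H] [InnerProductSpace ℂ H]
    [NormedAddCommGroup E] [InnerProductSpace ℂ E] [FiniteDimensional ℂ E]
    (V : VesselData H E) {y : Fin 2 → ℂ} {w : E} (hw : w ≠ 0)
    (h : ∀ v : E, y 0 * inner ℂ v (V.σ₂ w) - y 1 * inner ℂ v (V.σ₁ w) +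
      inner ℂ v (V.γin w) = 0) : V.discriminant y = 0 := by
  refine LinearMap.det_eq_zero_iff_ker_ne_bot.2 ((Submodule.ne_bot_iff _).2 ⟨w, ?_, hw⟩)
  refine ext_inner_left ℂ fun v => ?_
  simpa [inner_add_right, inner_sub_right, inner_smul_right] using h v

/-- The inclusion of points: `r(y)` lies on the discriminant variety of the transformed vessel. -/
theorem VesselData.transform_discriminant_eq_zero {H E : Type*}
    [NormedAddCommGroup H] [InnerProductSpace ℂ H] [CompleteSpace H]
    [NormedAddCommGroup E] [InnerProductSpace ℂ E] [FiniteDimensional ℂ E] [CompleteSpace E]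
    (V : VesselData H E) (h₁ : IsSelfAdjoint V.σ₁) (h₂ : IsSelfAdjoint V.σ₂)
    (h₃ : IsSelfAdjoint V.γin) (p : Fin 3 → MvPolynomial (Fin 2) ℝ) (hn : 1 ≤ maxDegree p)
    (b₁₀ : BezoutTriple (maxDegree p)
      (homogenize (maxDegree p) (p 1)) (homogenize (maxDegree p) (p 0)))
    (b₂₀ : BezoutTriple (maxDegree p)
      (homogenize (maxDegree p) (p 2)) (homogenize (maxDegree p) (p 0)))
    (b₁₂ : BezoutTriple (maxDegree p)
      (homogenize (maxDegree p) (p 1)) (homogenize (maxDegree p) (p 2)))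
    {y : Fin 2 → ℂ} (hy : V.discriminant y = 0) (hy₀ : MvPolynomial.aeval y (p 0) ≠ 0) :
    (V.transform p b₁₀ b₂₀ b₁₂).discriminant
      ![MvPolynomial.aeval y (p 1) / MvPolynomial.aeval y (p 0),
        MvPolynomial.aeval y (p 2) / MvPolynomial.aeval y (p 0)] = 0 := by
  set z₁ := MvPolynomial.aeval y (p 1) / MvPolynomial.aeval y (p 0) with hz₁
  set z₂ := MvPolynomial.aeval y (p 2) / MvPolynomial.aeval y (p 0) with hz₂
  obtain ⟨u, hu, hu₀⟩ := (Submodule.ne_bot_iff _).1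
    (LinearMap.bot_lt_ker_of_det_eq_zero hy).ne'
  have hγ : V.γin u = y 1 • V.σ₁ u - y 0 • V.σ₂ u := by
    have h : y 0 • V.σ₂ u - y 1 • V.σ₁ u + V.γin u = 0 := by simpa using hu
    rw [eq_sub_iff_add_eq, ← sub_eq_zero, ← h]
    abel
  let c : Fin 3 → ℂ := ![1, y 0, y 1]
  let w₀ : BlownSpace (maxDegree p) E := WithLp.toLp 2 fun i : Idx (maxDegree p) => (∏ a, c a ^ i.1 a) • u
  -- The relation at `j` is `cʲ` times the kernel equation for `u`.
  have hw₀ : w₀ ∈ V.principalSubspace (maxDegree p) := by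
    intro j hj
    have hc : ∀ a, ∏ k, c k ^ (Idx.up j hj a).1 k = (∏ k, c k ^ j k) * c a := by
      intro a
      simp only [Idx.up, Pi.add_apply, pow_add, Finset.prod_mul_distrib]
      congr 1
      rw [Finset.prod_eq_single a (by intro b _ hb; simp [Pi.single_eq_of_ne hb]) (by simp)]
      simp
    simp only [w₀, hc, map_smul, hγ]
    simp only [c, Matrix.cons_val]
    module
  let w : V.principalSubspace (maxDegree p) := ⟨w₀, hw₀⟩
  -- The component at exponent `(n - 1, 0, 0)`, which exists since `n ≥ 1`, is `u` because `c 0 =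
  -- 1`.
  have hw : w ≠ 0 := by
    intro h
    have h' := congrArg (fun x : V.principalSubspace (maxDegree p) =>
      (x : BlownSpace (maxDegree p) E) ⟨Pi.single 0 (maxDegree p - 1), by simp; omega⟩) h
    refine hu₀ ?_
    have e : ∏ k, c k ^ (Pi.single (M := fun _ : Fin 3 => ℕ) 0 (maxDegree p - 1) k) = 1 := by
      simp [Fin.prod_univ_three, c]
    have h'' : (∏ k, c k ^ (Pi.single (M := fun _ : Fin 3 => ℕ) 0 (maxDegree p - 1) k)) • u = 0 := h'
    rwa [e, one_smul] at h''
  -- The `β₁₂` terms are absorbed by `X₁ c₂ - X₂ c₁ = c₂ (X₁ - c₁ X₀) - c₁ (X₂ - c₂ X₀)`. The left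
  -- sides of the three Bezout identities, weighted by `z₁`, `-z₂`, `1`, cancel.
  have hsyz : (MvPolynomial.X 1 - MvPolynomial.C (y 0) * MvPolynomial.X 0) *
      (z₁ • (bezoutRow b₂₀.β₁₀ c + y 1 • bezoutRow b₂₀.β₁₂ c) -
        z₂ • (bezoutRow b₁₀.β₁₀ c + y 1 • bezoutRow b₁₀.β₁₂ c) +
        (bezoutRow b₁₂.β₁₀ c + y 1 • bezoutRow b₁₂.β₁₂ c)) +
      (MvPolynomial.X 2 - MvPolynomial.C (y 1) * MvPolynomial.X 0) *
      (z₁ • (bezoutRow b₂₀.β₂₀ c - y 0 • bezoutRow b₂₀.β₁₂ c) -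
        z₂ • (bezoutRow b₁₀.β₂₀ c - y 0 • bezoutRow b₁₀.β₁₂ c) +
        (bezoutRow b₁₂.β₂₀ c - y 0 • bezoutRow b₁₂.β₁₂ c)) = 0 := by
    have i₁ := b₁₀.specialize_identity c
    have i₂ := b₂₀.specialize_identity c
    have i₃ := b₁₂.specialize_identity c
    have e₁ : MvPolynomial.aeval y (p 1) = z₁ * MvPolynomial.aeval y (p 0) := by
      rw [hz₁, div_mul_cancel₀ _ hy₀]
    have e₂ : MvPolynomial.aeval y (p 2) = z₂ * MvPolynomial.aeval y (p 0) := by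
      rw [hz₂, div_mul_cancel₀ _ hy₀]
    simp only [c, aeval_homogenize, e₁, e₂, Matrix.cons_val, map_mul, map_one] at i₁ i₂ i₃
    simp only [MvPolynomial.smul_eq_C_mul, c]
    linear_combination -MvPolynomial.C z₁ * i₂ + MvPolynomial.C z₂ * i₁ - i₃
  obtain ⟨q, hq₁, hq₂⟩ := exists_koszul_factor hsyz
  have key : ∀ v ∈ V.principalSubspace (maxDegree p), z₁ * inner ℂ v
        ((tensorOp b₂₀.β₁₂ V.γin + tensorOp b₂₀.β₁₀ V.σ₁ + tensorOp b₂₀.β₂₀ V.σ₂) w₀) -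
      z₂ * inner ℂ v
        ((tensorOp b₁₀.β₁₂ V.γin + tensorOp b₁₀.β₁₀ V.σ₁ + tensorOp b₁₀.β₂₀ V.σ₂) w₀) +
      inner ℂ v
        ((tensorOp b₁₂.β₁₂ V.γin + tensorOp b₁₂.β₁₀ V.σ₁ + tensorOp b₁₂.β₂₀ V.σ₂) w₀) = 0 := by
    intro v hv
    have h := blownPairing_principalSubspace V h₁ h₂ h₃ hv u q
    have k₁ := congrArg (blownPairing v (V.σ₁ u)) hq₁
    have k₂ := congrArg (blownPairing v (V.σ₂ u)) hq₂
    simp only [sub_mul, ← MvPolynomial.smul_eq_C_mul, smul_mul_assoc, map_add, map_sub, map_neg,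
      map_smul, smul_eq_mul] at k₁ k₂
    simp only [_root_.add_apply, inner_add_right, w₀, blownPairing_bezoutRow]
    rw [hγ] at h ⊢
    simp only [blownPairing_sub, blownPairing_smul] at h ⊢
    -- `k₁`, `k₂` insert the Koszul form of the coefficients of `σ₁ u` and `σ₂ u`; their sum is
    -- minus the expression that `h` says vanishes.
    linear_combination k₁ + k₂ - h
  -- Against `v ∈ V_n` the orthogonal projection in the compression disappears.
  have hB : ∀ {P Q : MvPolynomial (Fin 3) ℝ} (b : BezoutTriple (maxDegree p) P Q) (v : V.principalSubspace (maxDegree p)),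
      inner ℂ v (V.bezout b w) = inner ℂ (v : BlownSpace (maxDegree p) E)
        ((tensorOp b.β₁₂ V.γin + tensorOp b.β₁₀ V.σ₁ + tensorOp b.β₂₀ V.σ₂) w₀) := by
    intro P Q b v
    exact Submodule.inner_orthogonalProjectionOnto_eq_of_mem_left v _
  refine VesselData.discriminant_eq_zero_of_inner _ hw fun v => ?_
  have h := key v v.2
  simp only [← hB] at h
  exact h

/-- The discriminant variety of the transformed vessel contains the image curve `C' = r(C)`,
for every choice of the matrices `β¹⁰, β²⁰, β¹²` that enter the Bezout matrices. -/
theorem theorem3p2 {H E : Type*}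
    [NormedAddCommGroup H] [InnerProductSpace ℂ H] [CompleteSpace H]
    [NormedAddCommGroup E] [InnerProductSpace ℂ E] [FiniteDimensional ℂ E] [CompleteSpace E]
    (V : VesselData H E) (hV : V.IsVessel)
    (p : Fin 3 → MvPolynomial (Fin 2) ℝ) (hn : 1 ≤ maxDegree p)
    (hp₀ : IsUnit (opEval (p 0) V.A₁ V.A₂))
    (b₁₀ : BezoutTriple (maxDegree p)
      (homogenize (maxDegree p) (p 1)) (homogenize (maxDegree p) (p 0)))
    (b₂₀ : BezoutTriple (maxDegree p)
      (homogenize (maxDegree p) (p 2)) (homogenize (maxDegree p) (p 0)))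
    (b₁₂ : BezoutTriple (maxDegree p)
      (homogenize (maxDegree p) (p 1)) (homogenize (maxDegree p) (p 2))) :
    imageCurve V p ⊆ (V.transform p b₁₀ b₂₀ b₁₂).discriminantVariety := by

  obtain ⟨F, hF⟩ := (V.transform p b₁₀ b₂₀ b₁₂).exists_discriminant_eq_aeval
  intro z hz
  have hmem : F ∈ MvPolynomial.vanishingIdeal ℂ
      {z : Fin 2 → ℂ | ∃ y ∈ V.discriminantVariety, MvPolynomial.aeval y (p 0) ≠ 0 ∧
        z = ![MvPolynomial.aeval y (p 1) / MvPolynomial.aeval y (p 0),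
              MvPolynomial.aeval y (p 2) / MvPolynomial.aeval y (p 0)]} := by
    rw [MvPolynomial.mem_vanishingIdeal_iff]
    rintro _ ⟨y, hy, hy₀, rfl⟩
    rw [← hF]
    exact V.transform_discriminant_eq_zero hV.selfAdjoint_σ₁ hV.selfAdjoint_σ₂
      hV.selfAdjoint_γin p hn b₁₀ b₂₀ b₁₂ hy hy₀
  exact (hF z).trans (MvPolynomial.mem_zeroLocus_iff.1 hz F hmem)
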